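/- Let $n\ge 1$ and let $\mathbb H^n=\mathbb C^n\times\mathbb R$ be the Heisenberg group with group law $$(z,t)\cdot(w,s)=\bigl(z+w,\;t+s+\tfrac12\operatorname{Im}(z\cdot\bar w)\bigr),$$ where $z\cdot\bar w=\sum_{j=1}^n z_j\overline{w_j}$, equipped with Lebesgue measure $dz\,dt$. For $\lambda\in\mathbb R^\ast=\mathbb R\setminus\{0\}$ let $\pi_\lambda$ be the Schrödinger representation of $\mathbb H^n$ on $L^2(\mathbb R^n)$, $$\pi_\lambda(z,t)\varphi(\xi)=e^{i\lambda t}\,e^{i\lambda(x\cdot\xi+\frac12 x\cdot y)}\,\varphi(\xi+y),\qquad z=x+iy,$$ and for $f\in L^1(\mathbb H^n)$ let $$\hat f(\lambda)=\int_{\mathbb H^n}f(z,t)\,\pi_\lambda(z,t)\,dz\,dt$$ be its group Fourier transform, a bounded operator on $L^2(\mathbb R^n)$ (the integral being taken in the strong operator sense). Let $A\subset\mathbb C^n$ be a set of finite Lebesgue measure. Suppose that $f\in L^1(\mathbb H^n)$ and that $f(z,t)=0$ for almost every $(z,t)\notin A\times\mathbb R$. If $\hat f(\lambda)$ is a finite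 rank operator for each $\lambda\in\mathbb R^\ast$, then $f=0$ (as an element of $L^1(\mathbb H^n)$, i.e. $f=0$ almost everywhere). -/

import Mathlib

open MeasureTheory Filter Topology
open scoped ENNReal

noncomputable section

/-- The Heisenberg group `ℂⁿ × ℝ`. It carries the product topology and Lebesgue measure
`dz dt` (where `dz = dx dy` for `z = x + i y`). -/
def HeisenbergGroup (n : ℕ) : Type := (Fin n → ℂ) × ℝ

namespace HeisenbergGroup

variable {n : ℕ}

/-- The `ℂⁿ`-component `z` of a point `(z, t)`. -/
def z (g : HeisenbergGroup n) : Fin n → ℂ := g.1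

/-- The central component `t` of a point `(z, t)`. -/
def t (g : HeisenbergGroup n) : ℝ := g.2

/-- The real part `x` of `z = x + i y`. -/
def x (g : HeisenbergGroup n) : Fin n → ℝ := fun j => (g.z j).re

/-- The imaginary part `y` of `z = x + i y`. -/
def y (g : HeisenbergGroup n) : Fin n → ℝ := fun j => (g.z j).im

instance : TopologicalSpace (HeisenbergGroup n) :=
  inferInstanceAs (TopologicalSpace ((Fin n → ℂ) × ℝ))

instance : SecondCountableTopology (HeisenbergGroup n) :=
  inferInstanceAs (SecondCountableTopology ((Fin n → ℂ) × ℝ))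

instance : TopologicalSpace.PseudoMetrizableSpace (HeisenbergGroup n) :=
  inferInstanceAs (TopologicalSpace.PseudoMetrizableSpace ((Fin n → ℂ) × ℝ))

instance : MeasureSpace (HeisenbergGroup n) :=
  inferInstanceAs (MeasureSpace ((Fin n → ℂ) × ℝ))

instance : BorelSpace (HeisenbergGroup n) :=
  inferInstanceAs (BorelSpace ((Fin n → ℂ) × ℝ))

instance : One (HeisenbergGroup n) := ⟨((0 : Fin n → ℂ), (0 : ℝ))⟩

/-- The inverse `(z, t)⁻¹ = (-z, -t)`. -/
instance : Inv (HeisenbergGroup n) := ⟨fun g => (-g.z, -g.t)⟩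

/-- The group law `(z, t) (w, s) = (z + w, t + s + Im (z · w̄) / 2)`. -/
instance : Mul (HeisenbergGroup n) :=
  ⟨fun g h => (g.z + h.z, g.t + h.t + 1 / 2 * (∑ j, g.z j * starRingEnd ℂ (h.z j)).im)⟩

theorem ext {g h : HeisenbergGroup n} (h₁ : g.z = h.z) (h₂ : g.t = h.t) : g = h :=
  Prod.ext h₁ h₂

theorem z_one : (1 : HeisenbergGroup n).z = 0 := rfl
theorem t_one : (1 : HeisenbergGroup n).t = 0 := rfl
theorem z_inv (g : HeisenbergGroup n) : g⁻¹.z = -g.z := rfl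
theorem t_inv (g : HeisenbergGroup n) : g⁻¹.t = -g.t := rfl
theorem z_mul (g h : HeisenbergGroup n) : (g * h).z = g.z + h.z := rfl
theorem t_mul (g h : HeisenbergGroup n) :
    (g * h).t = g.t + h.t + 1 / 2 * (∑ j, g.z j * starRingEnd ℂ (h.z j)).im := rfl

theorem t_mul' (g h : HeisenbergGroup n) :
    (g * h).t = g.t + h.t + 1 / 2 * ((g.y ⬝ᵥ h.x) - (g.x ⬝ᵥ h.y)) := by
  rw [t_mul, Complex.im_sum]
  simp only [dotProduct, x, y, ← Finset.sum_sub_distrib]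
  congr 2
  refine Finset.sum_congr rfl fun j _ => ?_
  simp
  ring

theorem x_mul (g h : HeisenbergGroup n) : (g * h).x = g.x + h.x := by
  ext j; simp [x, z_mul]

theorem y_mul (g h : HeisenbergGroup n) : (g * h).y = g.y + h.y := by
  ext j; simp [y, z_mul]

instance : Group (HeisenbergGroup n) :=
  Group.ofLeftAxioms
    (fun a b c => ext (by simp only [z_mul, add_assoc]) (by
      simp only [t_mul', x_mul, y_mul, add_dotProduct, dotProduct_add]; ring))
    (fun a => ext (by simp [z_mul, z_one]) (by simp [t_mul, t_one, z_one]))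
    (fun a => ext (by simp [z_mul, z_inv, z_one]) (by
      have hx : a⁻¹.x = -a.x := by ext j; simp [x, z_inv]
      have hy : a⁻¹.y = -a.y := by ext j; simp [y, z_inv]
      rw [t_mul', hx, hy, t_inv, t_one, neg_dotProduct, neg_dotProduct, dotProduct_comm a.y]
      ring))

theorem continuous_t : Continuous (t : HeisenbergGroup n → ℝ) :=
  (continuous_snd : Continuous (Prod.snd : (Fin n → ℂ) × ℝ → ℝ))

theorem continuous_z : Continuous (z : HeisenbergGroup n → Fin n → ℂ) :=
  (continuous_fst : Continuous (Prod.fst : (Fin n → ℂ) × ℝ → Fin n → ℂ))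

theorem continuous_x : Continuous (x : HeisenbergGroup n → Fin n → ℝ) :=
  continuous_pi fun j => Complex.continuous_re.comp ((continuous_apply j).comp continuous_z)

theorem continuous_y : Continuous (y : HeisenbergGroup n → Fin n → ℝ) :=
  continuous_pi fun j => Complex.continuous_im.comp ((continuous_apply j).comp continuous_z)

/-- The complex Hilbert space `L²(ℝⁿ)` with respect to Lebesgue measure. -/
abbrev L2 (n : ℕ) : Type := Lp ℂ 2 (volume : Measure (Fin n → ℝ))

/-- The function `ξ ↦ e^{iλt} e^{iλ(x·ξ + x·y/2)} φ(ξ + y)`, where `g = (x + i y, t)`. -/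
def schrodingerFun (lam : ℝ) (g : HeisenbergGroup n) (φ : (Fin n → ℝ) → ℂ) (ξ : Fin n → ℝ) : ℂ :=
  Complex.exp (Complex.I * ((lam * g.t : ℝ) : ℂ)) *
    Complex.exp (Complex.I * ((lam * (g.x ⬝ᵥ ξ + 1 / 2 * (g.x ⬝ᵥ g.y)) : ℝ) : ℂ)) *
    φ (ξ + g.y)

/-- The unimodular factor of `schrodingerFun`. -/
def phase (lam : ℝ) (g : HeisenbergGroup n) (ξ : Fin n → ℝ) : ℂ :=
  Complex.exp (Complex.I * ((lam * g.t : ℝ) : ℂ)) *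
    Complex.exp (Complex.I * ((lam * (g.x ⬝ᵥ ξ + 1 / 2 * (g.x ⬝ᵥ g.y)) : ℝ) : ℂ))

theorem norm_phase (lam : ℝ) (g : HeisenbergGroup n) (ξ : Fin n → ℝ) : ‖phase lam g ξ‖ = 1 := by
  rw [phase, norm_mul, mul_comm Complex.I, mul_comm Complex.I, Complex.norm_exp_ofReal_mul_I,
    Complex.norm_exp_ofReal_mul_I, mul_one]

theorem continuous_phase (lam : ℝ) :
    Continuous fun p : HeisenbergGroup n × (Fin n → ℝ) => phase lam p.1 p.2 := by
  have ht : Continuous fun p : HeisenbergGroup n × (Fin n → ℝ) => p.1.t :=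
    continuous_t.comp continuous_fst
  have hx : Continuous fun p : HeisenbergGroup n × (Fin n → ℝ) => p.1.x :=
    continuous_x.comp continuous_fst
  have hy : Continuous fun p : HeisenbergGroup n × (Fin n → ℝ) => p.1.y :=
    continuous_y.comp continuous_fst
  have h1 : Continuous fun p : HeisenbergGroup n × (Fin n → ℝ) => p.1.x ⬝ᵥ p.2 :=
    hx.dotProduct continuous_snd
  have h2 : Continuous fun p : HeisenbergGroup n × (Fin n → ℝ) => p.1.x ⬝ᵥ p.1.y :=
    hx.dotProduct hy
  unfold phase
  fun_prop

theorem continuous_phase_right (lam : ℝ) (g : HeisenbergGroup n) : Continuous (phase lam g) :=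
  (continuous_phase lam).comp (by fun_prop : Continuous fun ξ : Fin n → ℝ => (g, ξ))

theorem schrodingerFun_eq (lam : ℝ) (g : HeisenbergGroup n) (φ : (Fin n → ℝ) → ℂ) :
    schrodingerFun lam g φ = fun ξ => phase lam g ξ * φ (ξ + g.y) := rfl

theorem memLp_schrodingerFun (lam : ℝ) (g : HeisenbergGroup n) {φ : (Fin n → ℝ) → ℂ}
    (hφ : MemLp φ 2 volume) : MemLp (schrodingerFun lam g φ) 2 volume := by
  have h := hφ.comp_measurePreserving (measurePreserving_add_right volume g.y)
  refine MemLp.of_le h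
    ((continuous_phase_right lam g).aestronglyMeasurable.mul h.aestronglyMeasurable) ?_
  refine Eventually.of_forall fun ξ => ?_
  rw [schrodingerFun_eq]
  simp [norm_phase]

theorem schrodingerFun_congr (lam : ℝ) (g : HeisenbergGroup n) {φ ψ : (Fin n → ℝ) → ℂ}
    (h : φ =ᵐ[volume] ψ) : schrodingerFun lam g φ =ᵐ[volume] schrodingerFun lam g ψ := by
  filter_upwards [(measurePreserving_add_right volume g.y).quasiMeasurePreserving.ae_eq_comp h]
    with ξ hξ
  simp only [Function.comp_apply] at hξ
  simp only [schrodingerFun, hξ]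

theorem schrodingerFun_mul (lam : ℝ) (g h : HeisenbergGroup n) (φ : (Fin n → ℝ) → ℂ) :
    schrodingerFun lam (g * h) φ = schrodingerFun lam g (schrodingerFun lam h φ) := by
  ext ξ
  simp only [schrodingerFun, t_mul', x_mul, y_mul, ← mul_assoc, ← Complex.exp_add,
    add_dotProduct, dotProduct_add, add_assoc]
  rw [dotProduct_comm g.y h.x]
  congr 2
  push_cast
  ring

theorem schrodingerFun_one (lam : ℝ) (φ : (Fin n → ℝ) → ℂ) :
    schrodingerFun lam 1 φ = φ := by
  have hx : (1 : HeisenbergGroup n).x = 0 := rfl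
  have hy : (1 : HeisenbergGroup n).y = 0 := rfl
  ext ξ
  simp [schrodingerFun, hx, hy, t_one]

/-- `schrodingerFun` as a linear isometry of `L²(ℝⁿ)`. -/
def schrodingerIsometry (lam : ℝ) (g : HeisenbergGroup n) : L2 n →ₗᵢ[ℂ] L2 n where
  toFun φ := (memLp_schrodingerFun lam g (Lp.memLp φ)).toLp (schrodingerFun lam g φ)
  map_add' φ ψ := by
    rw [← MemLp.toLp_add]
    refine MemLp.toLp_congr _ _ ((schrodingerFun_congr lam g (Lp.coeFn_add φ ψ)).trans ?_)
    exact Eventually.of_forall fun ξ => by simp [schrodingerFun, mul_add]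
  map_smul' c φ := by
    rw [RingHom.id_apply, ← MemLp.toLp_const_smul]
    refine MemLp.toLp_congr _ _ ((schrodingerFun_congr lam g (Lp.coeFn_smul c φ)).trans ?_)
    exact Eventually.of_forall fun ξ => by simp [schrodingerFun]; ring
  norm_map' φ := by
    change ‖(memLp_schrodingerFun lam g (Lp.memLp φ)).toLp (schrodingerFun lam g φ)‖ = ‖φ‖
    rw [Lp.norm_toLp, Lp.norm_def]
    congr 1
    rw [← eLpNorm_comp_measurePreserving (Lp.aestronglyMeasurable φ)
      (measurePreserving_add_right volume g.y)]
    refine eLpNorm_congr_norm_ae (Eventually.of_forall fun ξ => ?_)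
    rw [schrodingerFun_eq]
    simp [norm_phase]

theorem coeFn_schrodingerIsometry (lam : ℝ) (g : HeisenbergGroup n) (φ : L2 n) :
    schrodingerIsometry lam g φ =ᵐ[volume] schrodingerFun lam g φ :=
  MemLp.coeFn_toLp (memLp_schrodingerFun lam g (Lp.memLp φ))

theorem schrodingerIsometry_mul (lam : ℝ) (g h : HeisenbergGroup n) (φ : L2 n) :
    schrodingerIsometry lam (g * h) φ =
      schrodingerIsometry lam g (schrodingerIsometry lam h φ) := by
  refine Lp.ext ?_
  refine (coeFn_schrodingerIsometry lam (g * h) φ).trans ?_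
  rw [schrodingerFun_mul]
  exact ((coeFn_schrodingerIsometry lam g _).trans
    (schrodingerFun_congr lam g (coeFn_schrodingerIsometry lam h φ))).symm

theorem schrodingerIsometry_one (lam : ℝ) (φ : L2 n) :
    schrodingerIsometry lam (1 : HeisenbergGroup n) φ = φ := by
  refine Lp.ext ((coeFn_schrodingerIsometry lam 1 φ).trans ?_)
  rw [schrodingerFun_one]

/-- The Schrödinger representation `π_λ` of the Heisenberg group on `L²(ℝⁿ)`, by unitary
operators: `π_λ(z, t) φ (ξ) = e^{iλt} e^{iλ(x·ξ + x·y/2)} φ(ξ + y)` for `z = x + i y`. -/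
def schrodingerRep (n : ℕ) (lam : ℝ) : HeisenbergGroup n →* (L2 n ≃ₗᵢ[ℂ] L2 n) where
  toFun g :=
    { toLinearEquiv :=
        { toLinearMap := (schrodingerIsometry lam g).toLinearMap
          invFun := schrodingerIsometry lam g⁻¹
          left_inv := fun φ => by
            change schrodingerIsometry lam g⁻¹ (schrodingerIsometry lam g φ) = φ
            rw [← schrodingerIsometry_mul, inv_mul_cancel, schrodingerIsometry_one]
          right_inv := fun φ => by
            change schrodingerIsometry lam g (schrodingerIsometry lam g⁻¹ φ) = φ
            rw [← schrodingerIsometry_mul, mul_inv_cancel, schrodingerIsometry_one] }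
      norm_map' := (schrodingerIsometry lam g).norm_map }
  map_one' := LinearIsometryEquiv.ext (schrodingerIsometry_one lam)
  map_mul' g h := LinearIsometryEquiv.ext (schrodingerIsometry_mul lam g h)

theorem schrodingerRep_apply (lam : ℝ) (g : HeisenbergGroup n) (φ : L2 n) :
    schrodingerRep n lam g φ = schrodingerIsometry lam g φ := rfl

theorem tendsto_translate (φ : L2 n) (v₀ : Fin n → ℝ) :
    Tendsto (fun v : Fin n → ℝ => eLpNorm (fun ξ => φ (ξ + v) - φ (ξ + v₀)) 2 volume)
      (𝓝 v₀) (𝓝 0) := by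
  have hc : Continuous fun v : Fin n → ℝ =>
      (ContinuousMap.mk (fun ξ : Fin n → ℝ => ξ + v) (by fun_prop) :
        C(Fin n → ℝ, Fin n → ℝ)) :=
    ContinuousMap.continuous_of_continuous_uncurry _ (by
      change Continuous fun p : (Fin n → ℝ) × (Fin n → ℝ) => p.2 + p.1
      fun_prop)
  have h := (Continuous.compMeasurePreservingLp (p := 2) (continuous_const (y := φ)) hc
    (fun v => measurePreserving_add_right volume v) (by norm_num)).tendsto v₀
  rw [Lp.tendsto_Lp_iff_tendsto_eLpNorm'] at h
  refine h.congr fun v => eLpNorm_congr_ae ?_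
  filter_upwards [Lp.coeFn_compMeasurePreserving φ (measurePreserving_add_right volume v),
    Lp.coeFn_compMeasurePreserving φ (measurePreserving_add_right volume v₀)] with ξ h₁ h₂
  simp only [Pi.sub_apply]
  exact congrArg₂ (· - ·) h₁ h₂

theorem tendsto_phase (lam : ℝ) (g₀ : HeisenbergGroup n) {ψ : (Fin n → ℝ) → ℂ}
    (hψ : MemLp ψ 2 volume) :
    Tendsto (fun g => eLpNorm (fun ξ => (phase lam g ξ - phase lam g₀ ξ) * ψ ξ) 2 volume)
      (𝓝 g₀) (𝓝 0) := by
  have key : Tendsto (fun g : HeisenbergGroup n =>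
      ∫⁻ ξ, ‖(phase lam g ξ - phase lam g₀ ξ) * ψ ξ‖ₑ ^ (2 : ℝ)) (𝓝 g₀)
      (𝓝 (∫⁻ _ : Fin n → ℝ, 0)) := by
    refine tendsto_lintegral_filter_of_dominated_convergence'
      (fun ξ => ‖(2 : ℂ) * ψ ξ‖ₑ ^ (2 : ℝ)) ?_ ?_ ?_ ?_
    · refine Eventually.of_forall fun g => ?_
      exact (((((continuous_phase_right lam g).sub
        (continuous_phase_right lam g₀)).aestronglyMeasurable).mul
          hψ.aestronglyMeasurable).enorm).pow_const _
    · refine Eventually.of_forall fun g => Eventually.of_forall fun ξ => ?_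
      refine ENNReal.rpow_le_rpow ?_ (by norm_num)
      rw [enorm_mul, enorm_mul]
      gcongr
      refine enorm_le_iff_norm_le.2 ((norm_sub_le _ _).trans ?_)
      rw [norm_phase, norm_phase]
      norm_num
    · have h2 := (hψ.const_mul (2 : ℂ))
      exact (lintegral_rpow_enorm_lt_top_of_eLpNorm_lt_top (by norm_num) (by norm_num)
        h2.eLpNorm_lt_top).ne
    · refine Eventually.of_forall fun ξ => ?_
      have hc : Continuous fun g : HeisenbergGroup n =>
          ‖(phase lam g ξ - phase lam g₀ ξ) * ψ ξ‖ₑ ^ (2 : ℝ) := by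
        have h1 : Continuous fun g : HeisenbergGroup n => phase lam g ξ :=
          (continuous_phase lam).comp
            (by fun_prop : Continuous fun g : HeisenbergGroup n => (g, ξ))
        exact (ENNReal.continuous_rpow_const).comp
          (((h1.sub continuous_const).mul continuous_const).enorm)
      simpa using hc.tendsto g₀
  rw [lintegral_zero] at key
  have h := (ENNReal.continuous_rpow_const (y := 1 / (2 : ℝ))).tendsto 0 |>.comp key
  rw [ENNReal.zero_rpow_of_pos (by norm_num)] at h
  refine h.congr fun g => ?_
  rw [eLpNorm_eq_lintegral_rpow_enorm_toReal (by norm_num) (by norm_num)]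
  simp

/-- Strong continuity of the Schrödinger representation. -/
theorem continuous_schrodingerRep (lam : ℝ) (φ : L2 n) :
    Continuous fun g : HeisenbergGroup n => schrodingerRep n lam g φ := by
  refine continuous_iff_continuousAt.2 fun g₀ => ?_
  change Tendsto _ _ _
  rw [Lp.tendsto_Lp_iff_tendsto_eLpNorm']
  have hsh : ∀ v : Fin n → ℝ, MemLp (fun ξ => φ (ξ + v)) 2 volume := fun v =>
    (Lp.memLp φ).comp_measurePreserving (measurePreserving_add_right volume v)
  have hsum := ((tendsto_translate φ g₀.y).comp (continuous_y.tendsto g₀)).add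
    (tendsto_phase lam g₀ (hsh g₀.y))
  rw [add_zero] at hsum
  refine tendsto_of_tendsto_of_tendsto_of_le_of_le tendsto_const_nhds hsum
    (fun _ => zero_le) fun g => ?_
  have e : eLpNorm (fun ξ => φ (ξ + g.y) - φ (ξ + g₀.y)) 2 volume =
      eLpNorm (fun ξ => phase lam g ξ * (φ (ξ + g.y) - φ (ξ + g₀.y))) 2 volume :=
    eLpNorm_congr_norm_ae (Eventually.of_forall fun ξ => by simp [norm_phase])
  simp only [Function.comp_apply]
  rw [e]
  refine le_trans (le_of_eq (eLpNorm_congr_ae ?_)) (eLpNorm_add_le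
    ((continuous_phase_right lam g).aestronglyMeasurable.mul
      ((hsh g.y).aestronglyMeasurable.sub (hsh g₀.y).aestronglyMeasurable))
    (((continuous_phase_right lam g).sub (continuous_phase_right lam g₀)).aestronglyMeasurable.mul
      (hsh g₀.y).aestronglyMeasurable) (by norm_num))
  filter_upwards [coeFn_schrodingerIsometry lam g φ, coeFn_schrodingerIsometry lam g₀ φ]
    with ξ h₁ h₂
  simp only [Pi.sub_apply, Pi.add_apply, schrodingerRep_apply, h₁, h₂,
    schrodingerFun_eq]
  ring

theorem integrable_schrodingerRep (lam : ℝ)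
    (f : Lp ℂ 1 (volume : Measure (HeisenbergGroup n))) (φ : L2 n) :
    Integrable fun g : HeisenbergGroup n => f g • schrodingerRep n lam g φ := by
  have hf : Integrable f (volume : Measure (HeisenbergGroup n)) := L1.integrable_coeFn f
  refine Integrable.mono (hf.norm.mul_const ‖φ‖)
    (hf.aestronglyMeasurable.smul (continuous_schrodingerRep lam φ).aestronglyMeasurable) ?_
  exact Eventually.of_forall fun g => by simp [norm_smul]

/-- The group Fourier transform `f̂(λ) = ∫ f(z, t) π_λ(z, t) dz dt` of `f ∈ L¹`, a bounded
operator on `L²(ℝⁿ)`. The integral is taken in the strong sense: `f̂(λ) φ` is the Bochner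
integral in `L²(ℝⁿ)` of the integrable function `(z, t) ↦ f(z, t) π_λ(z, t) φ`. -/
def fourierTransform (f : Lp ℂ 1 (volume : Measure (HeisenbergGroup n))) (lam : ℝ) :
    L2 n →L[ℂ] L2 n :=
  LinearMap.mkContinuous
    { toFun := fun φ => ∫ g : HeisenbergGroup n, f g • schrodingerRep n lam g φ
      map_add' := fun φ ψ => by
        rw [← integral_add (integrable_schrodingerRep lam f φ) (integrable_schrodingerRep lam f ψ)]
        simp only [map_add, smul_add]
      map_smul' := fun c φ => by
        rw [RingHom.id_apply, ← integral_smul]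
        simp only [map_smul, smul_comm c] }
    (∫ g : HeisenbergGroup n, ‖f g‖)
    (fun φ => by
      refine (norm_integral_le_integral_norm _).trans (le_of_eq ?_)
      rw [← integral_mul_const]
      simp only [norm_smul, LinearIsometryEquiv.norm_map])

theorem fourierTransform_apply (f : Lp ℂ 1 (volume : Measure (HeisenbergGroup n))) (lam : ℝ)
    (φ : L2 n) :
    fourierTransform f lam φ = ∫ g : HeisenbergGroup n, f g • schrodingerRep n lam g φ := rfl

end HeisenbergGroup

end

/-
The operator `f̂(λ)` is the Weyl transform `∫ f^λ(z) π_λ(z, 0) dz` of the partial Fourier transform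
`f^λ(z) = ∫ f(z, t) e^{iλt} dt`. If `f̂(λ) = ∑ i, ⟪a_i, ·⟫ e_i` has finite rank, with `(e_i)`
orthonormal, then by Moyal's identity `conj f^λ` is a constant multiple of the function
`z ↦ ∑ i, ⟪e_i, π_λ(z, 0) a_i⟫ = ⟪Φ z, a⟫`, where `Φ z = (π_λ(z, 0)⁻¹ e_i)_i` is a tight frame.

In a bounded tight frame the vectors `a` whose coefficient function `⟪Φ ·, a⟫` is supported in a
given set `B` of finite measure form a space of dimension at most a constant times `|B|`. But the
coefficient functions are permuted, up to phases, by translations. So, if one of them, not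
identically zero, were supported in a set of finite measure, then successive translates of it,
each of which moves the support by so little that the measure of the union stays bounded and by
enough that the union grows, would produce arbitrarily many independent coefficient functions
supported in a set of bounded measure. Hence `f^λ = 0` for all `λ ≠ 0`, and `f = 0`.
-/

noncomputable section

open scoped FourierTransform ComplexInnerProductSpace SchwartzMap

section Plancherel

variable {E : Type*} [NormedAddCommGroup E] [InnerProductSpace ℝ E] [FiniteDimensional ℝ E]
  [MeasurableSpace E] [BorelSpace E]

theorem integral_fourier_toLp_smul_schwartz {f : E → ℂ} (hf : Integrable f) (hf2 : MemLp f 2)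
    (φ : 𝓢(E, ℂ)) :
    ∫ ξ, φ ξ • (𝓕 (hf2.toLp f) : Lp ℂ 2 (volume : Measure E)) ξ = ∫ ξ, φ ξ • 𝓕 f ξ := by
  have h := congrArg (fun T => T φ) (Lp.fourier_toTemperedDistribution_eq (hf2.toLp f))
  simp only [TemperedDistribution.fourier_apply, Lp.toTemperedDistribution_apply] at h
  have hflip := VectorFourier.integral_fourierIntegral_smul_eq_flip (L := innerₗ E)
    Real.continuous_fourierChar (by exact continuous_inner) (φ.integrable (μ := volume)) hf
  rw [flip_innerₗ] at hflip
  calc ∫ ξ, φ ξ • (𝓕 (hf2.toLp f) : Lp ℂ 2 (volume : Measure E)) ξ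
      = ∫ x, (𝓕 φ) x • (hf2.toLp f) x := h.symm
    _ = ∫ x, (𝓕 φ) x • f x := by
        refine integral_congr_ae ?_
        filter_upwards [hf2.coeFn_toLp] with x hx
        rw [hx]
    _ = ∫ ξ, φ ξ • 𝓕 f ξ := hflip

theorem fourier_toLp_ae_eq {f : E → ℂ} (hf : Integrable f) (hf2 : MemLp f 2) :
    (𝓕 (hf2.toLp f) : Lp ℂ 2 (volume : Measure E)) =ᵐ[volume] 𝓕 f := by
  have hcont : Continuous (𝓕 f) := VectorFourier.fourierIntegral_continuous
    Real.continuous_fourierChar (by exact continuous_inner) hf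
  refine ae_eq_of_integral_contDiff_smul_eq ((Lp.memLp _).locallyIntegrable (by norm_num))
    hcont.locallyIntegrable fun g hg hgc => ?_
  exact integral_fourier_toLp_smul_schwartz hf hf2
    ((hgc.comp_left Complex.ofReal_zero).toSchwartzMap (Complex.ofRealCLM.contDiff.comp hg))

theorem memLp_fourier {f : E → ℂ} (hf : Integrable f) (hf2 : MemLp f 2) : MemLp (𝓕 f) 2 :=
  (memLp_congr_ae (fourier_toLp_ae_eq hf hf2)).1 (Lp.memLp _)

theorem integral_inner_fourier {f g : E → ℂ} (hf : Integrable f) (hf2 : MemLp f 2)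
    (hg : Integrable g) (hg2 : MemLp g 2) :
    ∫ ξ, ⟪𝓕 f ξ, 𝓕 g ξ⟫ = ∫ x, ⟪f x, g x⟫ := by
  have h := Lp.inner_fourier_eq (hf2.toLp f) (hg2.toLp g)
  rw [L2.inner_def, L2.inner_def] at h
  calc ∫ ξ, ⟪𝓕 f ξ, 𝓕 g ξ⟫ = _ := integral_congr_ae ?_
    _ = _ := h
    _ = ∫ x, ⟪f x, g x⟫ := integral_congr_ae ?_
  · filter_upwards [fourier_toLp_ae_eq hf hf2, fourier_toLp_ae_eq hg hg2] with ξ hfξ hgξ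
    rw [hfξ, hgξ]
  · filter_upwards [hf2.coeFn_toLp, hg2.coeFn_toLp] with x hfx hgx
    rw [hfx, hgx]

end Plancherel

section Uniqueness

theorem integrable_cexp_smul {X F : Type*} [MeasurableSpace X] {μ : Measure X}
    [NormedAddCommGroup F] [NormedSpace ℂ F] {k : X → F} (hk : Integrable k μ) {θ : X → ℝ}
    (hθ : Measurable θ) : Integrable (fun v => Complex.exp (θ v * Complex.I) • k v) μ := by
  refine hk.bdd_smul 1 (by fun_prop) (Eventually.of_forall fun v => ?_)
  exact (Complex.norm_exp_ofReal_mul_I _).le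

theorem exists_schwartz_fourier_eq {E : Type*} [NormedAddCommGroup E] [InnerProductSpace ℝ E]
    [FiniteDimensional ℝ E] [MeasurableSpace E] [BorelSpace E] {g : E → ℂ}
    (hg : ContDiff ℝ (⊤ : ℕ∞) g) (hgc : HasCompactSupport g) :
    ∃ φ : 𝓢(E, ℂ), 𝓕 (φ : E → ℂ) = g := by
  refine ⟨𝓕⁻ (hgc.toSchwartzMap hg), ?_⟩
  rw [← SchwartzMap.fourier_coe, FourierTransform.fourier_fourierInv_eq]
  rfl

variable {W F : Type*} [NormedAddCommGroup W] [NormedSpace ℝ W] [FiniteDimensional ℝ W]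
  [MeasurableSpace W] [BorelSpace W] {μ : Measure W} [SigmaFinite μ]
  [NormedAddCommGroup F] [NormedSpace ℂ F] [CompleteSpace F]

theorem ae_eq_zero_of_integral_cexp_smul {k : W → F} (hk : Integrable k μ)
    (h : ∀ L : StrongDual ℝ W, ∫ v, Complex.exp (L v * Complex.I) • k v ∂μ = 0) :
    k =ᵐ[μ] 0 := by
  refine ae_eq_zero_of_integral_contDiff_smul_eq_zero hk.locallyIntegrable fun g hg hgc => ?_
  let E := EuclideanSpace ℝ (Fin (Module.finrank ℝ W))
  let e : W ≃L[ℝ] E := toEuclidean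
  obtain ⟨φ, hφ⟩ := exists_schwartz_fourier_eq (g := fun u : E => (g (e.symm u) : ℂ))
    (Complex.ofRealCLM.contDiff.comp (hg.comp e.symm.contDiff))
    ((hgc.comp_homeomorph e.symm.toHomeomorph).comp_left Complex.ofReal_zero)
  let B : E →ₗ[ℝ] W →ₗ[ℝ] ℝ := (innerₗ E).compl₂ e.toLinearMap
  have hB : Continuous fun p : E × W => B p.1 p.2 :=
    continuous_fst.inner (e.continuous.comp continuous_snd)
  have hφg (v : W) : VectorFourier.fourierIntegral Real.fourierChar volume B φ v = (g v : ℂ) :=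
    (congrFun hφ (e v)).trans (by simp)
  have hk0 (ξ : E) : VectorFourier.fourierIntegral Real.fourierChar μ B.flip k ξ = 0 := by
    rw [← h (-(2 * Real.pi) • (innerSL ℝ ξ).comp e.toContinuousLinearMap)]
    refine integral_congr_ae (Eventually.of_forall fun v => ?_)
    simp [B, Circle.smul_def, Real.fourierChar_apply]
  calc ∫ v, g v • k v ∂μ
      = ∫ v, VectorFourier.fourierIntegral Real.fourierChar volume B φ v • k v ∂μ := by
        simp only [hφg, Complex.coe_smul]
    _ = ∫ ξ, φ ξ • VectorFourier.fourierIntegral Real.fourierChar μ B.flip k ξ :=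
        VectorFourier.integral_fourierIntegral_smul_eq_flip Real.continuous_fourierChar hB
          φ.integrable hk
    _ = 0 := by simp only [hk0, smul_zero, integral_zero]

theorem ae_eq_zero_of_integral_cexp_smul_of_dense {μ : Measure ℝ} [SigmaFinite μ] {k : ℝ → F}
    (hk : Integrable k μ) {D : Set ℝ} (hD : Dense D)
    (h : ∀ s ∈ D, ∫ t, Complex.exp ((s * t : ℝ) * Complex.I) • k t ∂μ = 0) : k =ᵐ[μ] 0 := by
  have hcont : Continuous fun s : ℝ => ∫ t, Complex.exp ((s * t : ℝ) * Complex.I) • k t ∂μ := by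
    refine continuous_of_dominated
      (fun s => (integrable_cexp_smul hk (θ := fun t => s * t) (by fun_prop)).1)
      (fun s => Eventually.of_forall fun t => ?_) hk.norm
      (Eventually.of_forall fun t => by fun_prop)
    rw [norm_smul, Complex.norm_exp_ofReal_mul_I, one_mul]
  have hzero := hcont.ext_on hD continuous_const h
  refine ae_eq_zero_of_integral_cexp_smul hk fun L => ?_
  have hL : ⇑L = fun t => L 1 * t := funext fun t => by simpa [mul_comm] using L.map_smul t 1
  rw [hL]
  exact congrFun hzero (L 1)

end Uniqueness

section Translation

variable {V : Type*} [TopologicalSpace V] [AddCommGroup V] [IsTopologicalAddGroup V]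
  [SecondCountableTopology V] [LocallyCompactSpace V]
  [MeasurableSpace V] [BorelSpace V] {μ : Measure V} [μ.IsAddHaarMeasure]

theorem continuous_measureReal_preimage_add_diff {A B : Set V} (hA : MeasurableSet A)
    (hA' : μ A ≠ ∞) (hB : MeasurableSet B) :
    Continuous fun w : V => μ.real ((fun z => z + w) ⁻¹' A \ B) := by
  let shift (w : V) : C(V, V) := ⟨fun z => z + w, by fun_prop⟩
  have hshift : Continuous shift := ContinuousMap.continuous_of_continuous_uncurry _ (by
    change Continuous fun p : V × V => p.2 + p.1
    fun_prop)
  have hLp := Continuous.compMeasurePreservingLp (p := 1)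
    (continuous_const (y := indicatorConstLp 1 hA hA' (1 : ℝ))) hshift
    (fun w => measurePreserving_add_right μ w) (by norm_num)
  refine ((continuous_setIntegral (μ := μ) Bᶜ).comp hLp).congr fun w => ?_
  simp only [Function.comp_apply]
  rw [Lp.indicatorConstLp_compMeasurePreserving, setIntegral_indicatorConstLp hB.compl]
  simp [shift, Set.sdiff_eq]

theorem lintegral_measure_inter_preimage_add {A B : Set V} (hA : MeasurableSet A)
    (hB : MeasurableSet B) :
    ∫⁻ w, μ (B ∩ (fun z => z + w) ⁻¹' A) ∂μ = μ B * μ A := by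
  have hpre := (measurePreserving_prod_add μ μ).measure_preimage (hB.prod hA).nullMeasurableSet
  rw [Measure.prod_prod, Measure.prod_apply_symm] at hpre
  · exact hpre
  · exact (measurePreserving_prod_add μ μ).measurable (hB.prod hA)

theorem exists_measureReal_preimage_add_diff_pos [NoncompactSpace V] {A B : Set V}
    (hA : MeasurableSet A) (hA' : μ A ≠ ∞) (hA0 : μ A ≠ 0) (hB : MeasurableSet B)
    (hB' : μ B ≠ ∞) : ∃ w : V, 0 < μ.real ((fun z => z + w) ⁻¹' A \ B) := by
  by_contra! hcon
  have hinter (w : V) : μ (B ∩ (fun z => z + w) ⁻¹' A) = μ A := by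
    have hpre : μ ((fun z => z + w) ⁻¹' A) = μ A :=
      (measurePreserving_add_right μ w).measure_preimage hA.nullMeasurableSet
    have hdiff : μ ((fun z => z + w) ⁻¹' A \ B) = 0 :=
      (measureReal_eq_zero_iff (measure_ne_top_of_subset Set.sdiff_subset (hpre ▸ hA'))).1
        ((hcon w).antisymm measureReal_nonneg)
    rw [← hpre, Set.inter_comm, ← add_zero (μ _), ← hdiff, measure_inter_add_sdiff _ hB]
  have htop := lintegral_measure_inter_preimage_add (μ := μ) hA hB
  simp only [hinter, lintegral_const, measure_univ_of_isAddLeftInvariant,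
    ENNReal.mul_top hA0] at htop
  exact ENNReal.mul_ne_top hB' hA' htop.symm

theorem exists_measureReal_preimage_add_diff_mem_Ioo [NoncompactSpace V] [ConnectedSpace V]
    {A B : Set V} (hA : MeasurableSet A) (hA' : μ A ≠ ∞) (hA0 : μ A ≠ 0) (hB : MeasurableSet B)
    (hB' : μ B ≠ ∞) (hAB : A ⊆ B) {ε : ℝ} (hε : 0 < ε) :
    ∃ w : V, μ.real ((fun z => z + w) ⁻¹' A \ B) ∈ Set.Ioo 0 ε := by
  obtain ⟨w₁, hw₁⟩ := exists_measureReal_preimage_add_diff_pos hA hA' hA0 hB hB'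
  obtain ⟨δ, hδ, hδ'⟩ := exists_between (lt_min hε hw₁)
  obtain ⟨w, hw⟩ := mem_range_of_exists_le_of_exists_ge
    (continuous_measureReal_preimage_add_diff (μ := μ) hA hA' hB) (c := δ)
    ⟨0, by simpa [Set.sdiff_eq_empty.2 hAB] using hδ.le⟩ ⟨w₁, (lt_min_iff.1 hδ').2.le⟩
  exact ⟨w, by simpa only [hw] using ⟨hδ, (lt_min_iff.1 hδ').1⟩⟩

end Translation

section TightFrame

variable {𝕜 H X : Type*} [RCLike 𝕜] [NormedAddCommGroup H] [InnerProductSpace 𝕜 H]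

variable (𝕜) in
/-- The vectors `a` whose coefficient function `z ↦ ⟪Φ z, a⟫` vanishes outside `B`. -/
def supportedIn (Φ : X → H) (B : Set X) : Submodule 𝕜 H := ⨅ z ∈ Bᶜ, (𝕜 ∙ Φ z)ᗮ

theorem mem_supportedIn {Φ : X → H} {B : Set X} {a : H} :
    a ∈ supportedIn 𝕜 Φ B ↔ ∀ z ∉ B, inner 𝕜 (Φ z) a = 0 := by
  simp only [supportedIn, Submodule.mem_iInf, Submodule.mem_orthogonal_singleton_iff_inner_right,
    Set.mem_compl_iff]

theorem supportedIn_lt_supportedIn_union {Φ : X → H} {B C : Set X} {b : H}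
    (hb : ∀ z, inner 𝕜 (Φ z) b ≠ 0 ↔ z ∈ C) (hCB : (C \ B).Nonempty) :
    supportedIn 𝕜 Φ B < supportedIn 𝕜 Φ (B ∪ C) := by
  obtain ⟨z, hzC, hzB⟩ := hCB
  refine SetLike.lt_iff_le_and_exists.2 ⟨fun a ha => ?_, b, ?_, fun hbB => ?_⟩
  · exact mem_supportedIn.2 fun z hz => mem_supportedIn.1 ha z fun hzB => hz (.inl hzB)
  · exact mem_supportedIn.2 fun z hz => not_not.1 fun hzb => hz (.inr ((hb z).1 hzb))
  · exact (hb z).2 hzC (mem_supportedIn.1 hbB z hzB)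

variable [MeasurableSpace X] {μ : Measure X}

variable (𝕜) in
/-- A continuous tight frame with frame bound `c`, indexed by the measure space `(X, μ)`. -/
structure IsTightFrame (μ : Measure X) (c : ℝ) (Φ : X → H) : Prop where
  memLp_inner (a : H) : MemLp (fun z => inner 𝕜 (Φ z) a) 2 μ
  integral_norm_inner_sq (a : H) : ∫ z, ‖inner 𝕜 (Φ z) a‖ ^ 2 ∂μ = c * ‖a‖ ^ 2

namespace IsTightFrame

variable {c r : ℝ} {Φ : X → H} {B : Set X}

theorem card_mul_le (hΦ : IsTightFrame 𝕜 μ c Φ) (hr : ∀ z, ‖Φ z‖ ^ 2 ≤ r) (hB : μ B ≠ ∞)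
    {ι : Type*} [Fintype ι] {u : ι → H} (hu : Orthonormal 𝕜 u)
    (huB : ∀ j, u j ∈ supportedIn 𝕜 Φ B) : Fintype.card ι * c ≤ r * μ.real B := by
  have hint (j : ι) : IntegrableOn (fun z => ‖inner 𝕜 (Φ z) (u j)‖ ^ 2) B μ :=
    ((hΦ.memLp_inner (u j)).integrable_norm_pow (by norm_num)).integrableOn
  have hbessel (z : X) : ∑ j, ‖inner 𝕜 (Φ z) (u j)‖ ^ 2 ≤ r := by
    simp only [norm_inner_symm (Φ z)]
    exact (hu.sum_inner_products_le (Φ z)).trans (hr z)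
  calc Fintype.card ι * c = ∑ j, ∫ z, ‖inner 𝕜 (Φ z) (u j)‖ ^ 2 ∂μ := by
        simp [hΦ.integral_norm_inner_sq, hu.1]
    _ = ∑ j, ∫ z in B, ‖inner 𝕜 (Φ z) (u j)‖ ^ 2 ∂μ := by
        refine Finset.sum_congr rfl fun j _ => ?_
        refine (setIntegral_eq_integral_of_forall_compl_eq_zero fun z hz => ?_).symm
        simp [mem_supportedIn.1 (huB j) z hz]
    _ = ∫ z in B, ∑ j, ‖inner 𝕜 (Φ z) (u j)‖ ^ 2 ∂μ :=
        (integral_finsetSum _ fun j _ => hint j).symm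
    _ ≤ ∫ _ in B, r ∂μ :=
        setIntegral_mono (integrable_finsetSum _ fun j _ => hint j) (integrableOn_const hB) hbessel
    _ = r * μ.real B := by rw [setIntegral_const, smul_eq_mul, mul_comm]

theorem finrank_mul_le (hΦ : IsTightFrame 𝕜 μ c Φ) (hr : ∀ z, ‖Φ z‖ ^ 2 ≤ r) (hB : μ B ≠ ∞)
    {S : Submodule 𝕜 H} [FiniteDimensional 𝕜 S] (hS : S ≤ supportedIn 𝕜 Φ B) :
    Module.finrank 𝕜 S * c ≤ r * μ.real B := by
  simpa using hΦ.card_mul_le hr hB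
    ((stdOrthonormalBasis 𝕜 S).orthonormal.comp_linearIsometry S.subtypeₗᵢ)
    fun j => hS (Subtype.coe_prop _)

theorem finiteDimensional_supportedIn (hΦ : IsTightFrame 𝕜 μ c Φ) (hr : ∀ z, ‖Φ z‖ ^ 2 ≤ r)
    (hc : 0 < c) (hB : μ B ≠ ∞) : FiniteDimensional 𝕜 (supportedIn 𝕜 Φ B) := by
  have hbound (s : Finset (supportedIn 𝕜 Φ B))
      (hs : LinearIndependent 𝕜 fun i : s => (i : supportedIn 𝕜 Φ B)) :
      s.card ≤ ⌊r * μ.real B / c⌋₊ := by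
    let v (i : s) : H := (i : supportedIn 𝕜 Φ B)
    have hv : LinearIndependent 𝕜 v :=
      hs.map' (supportedIn 𝕜 Φ B).subtype (Submodule.ker_subtype _)
    have hvB : Submodule.span 𝕜 (Set.range v) ≤ supportedIn 𝕜 Φ B :=
      Submodule.span_le.2 (Set.range_subset_iff.2 fun i => Subtype.coe_prop _)
    have := FiniteDimensional.span_of_finite 𝕜 (Set.finite_range v)
    have hcard := hΦ.finrank_mul_le hr hB hvB
    rw [finrank_span_eq_card hv, Fintype.card_coe] at hcard
    exact Nat.le_floor ((le_div_iff₀ hc).2 hcard)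
  exact Module.rank_lt_aleph0_iff.1 ((rank_le hbound).trans_lt Cardinal.natCast_lt_aleph0)

theorem measure_inner_ne_zero_ne_zero (hΦ : IsTightFrame 𝕜 μ c Φ) (hc : c ≠ 0) {a : H}
    (ha : a ≠ 0) : μ {z | inner 𝕜 (Φ z) a ≠ 0} ≠ 0 := fun h0 => by
  have h := hΦ.integral_norm_inner_sq a
  rw [integral_eq_zero_of_ae] at h
  · simp [hc, ha] at h
  · have h0' : ∀ᵐ z ∂μ, inner 𝕜 (Φ z) a = 0 := h0
    filter_upwards [h0'] with z hz
    simp [hz]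

end IsTightFrame

end TightFrame

section TranslationCovariantFrame

variable {V : Type*} [TopologicalSpace V] [AddCommGroup V] [IsTopologicalAddGroup V]
  [SecondCountableTopology V] [LocallyCompactSpace V] [ConnectedSpace V] [NoncompactSpace V]
  [MeasurableSpace V] [BorelSpace V] {μ : Measure V} [μ.IsAddHaarMeasure]
  {𝕜 H : Type*} [RCLike 𝕜] [NormedAddCommGroup H] [InnerProductSpace 𝕜 H]
  {c r : ℝ} {Φ : V → H}

theorem IsTightFrame.exists_le_finrank_supportedIn (hΦ : IsTightFrame 𝕜 μ c Φ)
    (hr : ∀ z, ‖Φ z‖ ^ 2 ≤ r) (hc : 0 < c)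
    (hcov : ∀ (w : V) (a : H), ∃ b, ∀ z, inner 𝕜 (Φ z) b = 0 ↔ inner 𝕜 (Φ (z + w)) a = 0)
    {a : H} (ha : a ≠ 0) (hmeas : MeasurableSet {z | inner 𝕜 (Φ z) a ≠ 0})
    (hfin : μ {z | inner 𝕜 (Φ z) a ≠ 0} ≠ ∞) (N : ℕ) :
    ∃ B, MeasurableSet B ∧ {z | inner 𝕜 (Φ z) a ≠ 0} ⊆ B ∧ μ B ≠ ∞ ∧
      μ.real B < μ.real {z | inner 𝕜 (Φ z) a ≠ 0} + 1 ∧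
      N ≤ Module.finrank 𝕜 (supportedIn 𝕜 Φ B) := by
  set A := {z | inner 𝕜 (Φ z) a ≠ 0}
  induction N with
  | zero => exact ⟨A, hmeas, subset_rfl, hfin, by linarith, Nat.zero_le _⟩
  | succ N ih =>
    obtain ⟨B, hB, hAB, hBfin, hBlt, hN⟩ := ih
    obtain ⟨w, hw0, hw1⟩ := exists_measureReal_preimage_add_diff_mem_Ioo hmeas hfin
      (hΦ.measure_inner_ne_zero_ne_zero hc.ne' ha) hB hBfin hAB (sub_pos.2 hBlt)
    obtain ⟨b, hb⟩ := hcov w a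
    set C := (fun z => z + w) ⁻¹' A
    have hC : MeasurableSet C := measurable_add_const w hmeas
    have hCfin : μ C ≠ ∞ := by
      rwa [(measurePreserving_add_right μ w).measure_preimage hmeas.nullMeasurableSet]
    have hUfin : μ (B ∪ C) ≠ ∞ := measure_union_ne_top hBfin hCfin
    have hCB : (C \ B).Nonempty := by
      by_contra h
      rw [Set.not_nonempty_iff_eq_empty.1 h, measureReal_empty] at hw0
      exact hw0.false
    have := hΦ.finiteDimensional_supportedIn hr hc hUfin
    refine ⟨B ∪ C, hB.union hC, hAB.trans Set.subset_union_left, hUfin, ?_, ?_⟩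
    · rw [← Set.union_sdiff_self]
      linarith [measureReal_union_le (μ := μ) B (C \ B)]
    · exact hN.trans_lt (Submodule.finrank_lt_finrank_of_lt
        (supportedIn_lt_supportedIn_union (fun z => (hb z).not) hCB))

theorem IsTightFrame.eq_zero_of_measure_ne_top (hΦ : IsTightFrame 𝕜 μ c Φ)
    (hr : ∀ z, ‖Φ z‖ ^ 2 ≤ r) (hc : 0 < c)
    (hcov : ∀ (w : V) (a : H), ∃ b, ∀ z, inner 𝕜 (Φ z) b = 0 ↔ inner 𝕜 (Φ (z + w)) a = 0)
    {a : H} (hmeas : MeasurableSet {z | inner 𝕜 (Φ z) a ≠ 0})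
    (hfin : μ {z | inner 𝕜 (Φ z) a ≠ 0} ≠ ∞) : a = 0 := by
  by_contra ha
  set A := {z | inner 𝕜 (Φ z) a ≠ 0}
  obtain ⟨N, hN⟩ := exists_nat_gt (r * (μ.real A + 1) / c)
  obtain ⟨B, -, -, hBfin, hBlt, hNB⟩ :=
    hΦ.exists_le_finrank_supportedIn hr hc hcov ha hmeas hfin N
  have := hΦ.finiteDimensional_supportedIn hr hc hBfin
  have hr0 : 0 ≤ r := (sq_nonneg _).trans (hr 0)
  have : r * (μ.real A + 1) < r * (μ.real A + 1) :=
    calc r * (μ.real A + 1) < N * c := (div_lt_iff₀ hc).1 hN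
      _ ≤ Module.finrank 𝕜 (supportedIn 𝕜 Φ B) * c := by gcongr
      _ ≤ r * μ.real B := hΦ.finrank_mul_le hr hBfin le_rfl
      _ ≤ r * (μ.real A + 1) := by gcongr
  exact this.false

end TranslationCovariantFrame

theorem exists_orthonormal_eq_sum_inner_smul {𝕜 E F : Type*} [RCLike 𝕜] [NormedAddCommGroup E]
    [InnerProductSpace 𝕜 E] [CompleteSpace E] [NormedAddCommGroup F] [InnerProductSpace 𝕜 F]
    [CompleteSpace F] (T : E →L[𝕜] F)
    (hT : FiniteDimensional 𝕜 (LinearMap.range T.toLinearMap)) :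
    ∃ (m : ℕ) (e : Fin m → F) (a : Fin m → E),
      Orthonormal 𝕜 e ∧ ∀ x, T x = ∑ i, inner 𝕜 (a i) x • e i := by
  let e := stdOrthonormalBasis 𝕜 (LinearMap.range T.toLinearMap)
  refine ⟨_, fun i => e i, fun i => ContinuousLinearMap.adjoint T (e i),
    e.orthonormal.comp_linearIsometry (Submodule.subtypeₗᵢ _), fun x => ?_⟩
  have h := congrArg Subtype.val (e.sum_repr' ⟨T x, LinearMap.mem_range_self _ x⟩)
  rw [Submodule.coe_sum] at h
  simp only [ContinuousLinearMap.adjoint_inner_left]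
  exact h.symm

section OscIntegral

variable {n : ℕ}

/-- The oscillatory integral `x ↦ ∫ e^{iλ x·ξ} f(ξ) dξ`: the Fourier transform on `ℝⁿ` in the
normalisation in which it occurs in the Schrödinger representation `π_λ`. -/
def oscIntegral (lam : ℝ) (f : (Fin n → ℝ) → ℂ) (x : Fin n → ℝ) : ℂ :=
  ∫ ξ, Complex.exp (Complex.I * ((lam * (x ⬝ᵥ ξ) : ℝ) : ℂ)) * f ξ

/-- The constant `(2π / |λ|)ⁿ` of Plancherel's identity for `oscIntegral`. -/
def oscConst (n : ℕ) (lam : ℝ) : ℝ := (2 * Real.pi / |lam|) ^ n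

theorem oscConst_pos (n : ℕ) {lam : ℝ} (hlam : lam ≠ 0) : 0 < oscConst n lam := by
  have := abs_pos.2 hlam
  unfold oscConst
  positivity

theorem oscIntegral_eq_fourier (lam : ℝ) (f : (Fin n → ℝ) → ℂ) (x : Fin n → ℝ) :
    oscIntegral lam f x =
      𝓕 (fun v : EuclideanSpace ℝ (Fin n) => f (WithLp.ofLp v))
        ((-(lam / (2 * Real.pi))) • WithLp.toLp 2 x) := by
  rw [Real.fourier_eq', oscIntegral, ← (PiLp.volume_preserving_toLp (Fin n)).integral_comp
    (MeasurableEquiv.toLp 2 (Fin n → ℝ)).measurableEmbedding]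
  refine integral_congr_ae (Eventually.of_forall fun ξ => ?_)
  have hπ := Real.pi_ne_zero
  simp only [smul_eq_mul, inner_smul_right, EuclideanSpace.inner_toLp_toLp, star_trivial]
  congr 2
  rw [mul_comm Complex.I]
  congr 2
  field_simp

theorem integral_comp_smul_toLp (G : EuclideanSpace ℝ (Fin n) → ℂ) (lam : ℝ) :
    ∫ x : Fin n → ℝ, G ((-(lam / (2 * Real.pi))) • WithLp.toLp 2 x) =
      oscConst n lam * ∫ v, G v := by
  have hconst : |((-(lam / (2 * Real.pi))) ^ n)⁻¹| = oscConst n lam := by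
    rw [oscConst, abs_inv, abs_pow, abs_neg, abs_div, abs_of_pos Real.two_pi_pos, ← inv_pow,
      inv_div]
  rw [← hconst, ← Complex.real_smul]
  have hscale := Measure.integral_comp_smul volume G (-(lam / (2 * Real.pi)))
  rw [finrank_euclideanSpace_fin] at hscale
  exact ((PiLp.volume_preserving_toLp (Fin n)).integral_comp
    (MeasurableEquiv.toLp 2 (Fin n → ℝ)).measurableEmbedding _).trans hscale

theorem integrable_comp_smul_toLp {G : EuclideanSpace ℝ (Fin n) → ℝ} (hG : Integrable G)
    {r : ℝ} (hr : r ≠ 0) : Integrable fun x : Fin n → ℝ => G (r • WithLp.toLp 2 x) :=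
  (PiLp.volume_preserving_toLp (Fin n)).integrable_comp_of_integrable
    ((integrable_comp_smul_iff volume G hr).2 hG)

theorem integrable_comp_ofLp {f : (Fin n → ℝ) → ℂ} (hf : Integrable f) :
    Integrable fun v : EuclideanSpace ℝ (Fin n) => f (WithLp.ofLp v) :=
  (PiLp.volume_preserving_ofLp (Fin n)).integrable_comp_of_integrable hf

theorem memLp_comp_ofLp {f : (Fin n → ℝ) → ℂ} {p : ℝ≥0∞} (hf : MemLp f p) :
    MemLp (fun v : EuclideanSpace ℝ (Fin n) => f (WithLp.ofLp v)) p :=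
  hf.comp_measurePreserving (PiLp.volume_preserving_ofLp (Fin n))

theorem integral_inner_oscIntegral (lam : ℝ) {f g : (Fin n → ℝ) → ℂ} (hf : Integrable f)
    (hf2 : MemLp f 2) (hg : Integrable g) (hg2 : MemLp g 2) :
    ∫ x, ⟪oscIntegral lam f x, oscIntegral lam g x⟫ = oscConst n lam * ∫ ξ, ⟪f ξ, g ξ⟫ := by
  let f' (v : EuclideanSpace ℝ (Fin n)) : ℂ := f (WithLp.ofLp v)
  let g' (v : EuclideanSpace ℝ (Fin n)) : ℂ := g (WithLp.ofLp v)
  simp only [oscIntegral_eq_fourier]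
  rw [integral_comp_smul_toLp fun v => ⟪𝓕 f' v, 𝓕 g' v⟫,
    integral_inner_fourier (integrable_comp_ofLp hf) (memLp_comp_ofLp hf2)
      (integrable_comp_ofLp hg) (memLp_comp_ofLp hg2)]
  congr 1
  exact (PiLp.volume_preserving_ofLp (Fin n)).integral_comp
    (MeasurableEquiv.toLp 2 (Fin n → ℝ)).symm.measurableEmbedding fun ξ => ⟪f ξ, g ξ⟫

theorem integrable_norm_oscIntegral_sq {lam : ℝ} (hlam : lam ≠ 0) {f : (Fin n → ℝ) → ℂ}
    (hf : Integrable f) (hf2 : MemLp f 2) : Integrable fun x => ‖oscIntegral lam f x‖ ^ 2 := by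
  have hr : -(lam / (2 * Real.pi)) ≠ 0 := neg_ne_zero.2 (div_ne_zero hlam Real.two_pi_pos.ne')
  simp only [oscIntegral_eq_fourier]
  exact integrable_comp_smul_toLp ((memLp_fourier (integrable_comp_ofLp hf)
    (memLp_comp_ofLp hf2)).integrable_norm_pow two_ne_zero) hr

theorem integral_norm_oscIntegral_sq (lam : ℝ) {f : (Fin n → ℝ) → ℂ} (hf : Integrable f)
    (hf2 : MemLp f 2) : ∫ x, ‖oscIntegral lam f x‖ ^ 2 = oscConst n lam * ∫ ξ, ‖f ξ‖ ^ 2 := by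
  have h := integral_inner_oscIntegral lam hf hf2 hf hf2
  simp only [inner_self_eq_norm_sq_to_K] at h
  apply Complex.ofReal_injective
  simpa [← integral_complex_ofReal] using h

end OscIntegral

namespace HeisenbergGroup

variable {n : ℕ}

section Moyal

/-- The element `(z, t)` of the Heisenberg group. -/
def of (z : Fin n → ℂ) (t : ℝ) : HeisenbergGroup n := (z, t)

theorem continuous_of : Continuous fun p : (Fin n → ℂ) × ℝ => of p.1 p.2 :=
  continuous_id (X := (Fin n → ℂ) × ℝ)

/-- The matrix coefficient `z ↦ ⟪β, π_λ(z, 0) α⟫` of the Schrödinger representation, also known as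
the Fourier–Wigner transform of `α` and `β`. -/
def coeff (lam : ℝ) (β α : L2 n) (z : Fin n → ℂ) : ℂ := ⟪β, schrodingerRep n lam (of z 0) α⟫

theorem continuous_coeff (lam : ℝ) (β α : L2 n) : Continuous (coeff lam β α) :=
  continuous_const.inner ((continuous_schrodingerRep lam α).comp
    (continuous_of.comp (by fun_prop : Continuous fun z : Fin n → ℂ => (z, (0 : ℝ)))))

theorem norm_coeff_le (lam : ℝ) (β α : L2 n) (z : Fin n → ℂ) :
    ‖coeff lam β α z‖ ≤ ‖β‖ * ‖α‖ := by
  refine (norm_inner_le_norm _ _).trans_eq ?_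
  rw [LinearIsometryEquiv.norm_map]

/-- The function `ξ ↦ α(ξ + y) conj β(ξ)`, whose oscillatory integral is, up to a phase, the matrix
coefficient `coeff lam β α (x + i y)`. -/
def crossTerm (β α : L2 n) (y ξ : Fin n → ℝ) : ℂ := α (ξ + y) * starRingEnd ℂ (β ξ)

theorem coeff_eq_oscIntegral (lam : ℝ) (β α : L2 n) (z : Fin n → ℂ) :
    coeff lam β α z =
      Complex.exp (((lam * (1 / 2 * ((of z 0).x ⬝ᵥ (of z 0).y)) : ℝ) : ℂ) * Complex.I) *
        oscIntegral lam (crossTerm β α (of z 0).y) (of z 0).x := by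
  rw [coeff, L2.inner_def, oscIntegral, ← integral_const_mul]
  refine integral_congr_ae ?_
  filter_upwards [coeFn_schrodingerIsometry lam (of z 0) α] with ξ hξ
  have ht : (of z 0).t = 0 := rfl
  rw [schrodingerRep_apply, hξ, RCLike.inner_apply, schrodingerFun, ht, crossTerm]
  simp only [mul_zero, Complex.ofReal_zero, Complex.exp_zero, one_mul, ← mul_assoc,
    ← Complex.exp_add]
  congr 3
  push_cast
  ring

/-- The identification `ℂⁿ ≃ ℝⁿ × ℝⁿ`, `z ↦ (Re z, Im z)`. -/
def reIm (n : ℕ) : (Fin n → ℂ) ≃ᵐ (Fin n → ℝ) × (Fin n → ℝ) :=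
  (MeasurableEquiv.piCongrRight fun _ => Complex.measurableEquivRealProd).trans
    (MeasurableEquiv.arrowProdEquivProdArrow ℝ ℝ (Fin n))

theorem measurePreserving_reIm_symm : MeasurePreserving (reIm n).symm :=
  MeasurePreserving.symm (reIm n)
    ((volume_measurePreserving_arrowProdEquivProdArrow ℝ ℝ (Fin n)).comp
      (volume_preserving_pi fun _ => Complex.volume_preserving_equiv_real_prod))

theorem inner_coeff_reIm_symm (lam : ℝ) (β α β' α' : L2 n) (p : (Fin n → ℝ) × (Fin n → ℝ)) :
    ⟪coeff lam β α ((reIm n).symm p), coeff lam β' α' ((reIm n).symm p)⟫ =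
      ⟪oscIntegral lam (crossTerm β α p.2) p.1, oscIntegral lam (crossTerm β' α' p.2) p.1⟫ := by
  have hx : (of ((reIm n).symm p) 0).x = p.1 := congrArg Prod.fst ((reIm n).apply_symm_apply p)
  have hy : (of ((reIm n).symm p) 0).y = p.2 := congrArg Prod.snd ((reIm n).apply_symm_apply p)
  rw [coeff_eq_oscIntegral, coeff_eq_oscIntegral, hx, hy]
  simp only [RCLike.inner_apply, map_mul]
  rw [mul_mul_mul_comm, Complex.mul_conj, Complex.normSq_eq_norm_sq,
    Complex.norm_exp_ofReal_mul_I]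
  simp

theorem norm_coeff_reIm_symm (lam : ℝ) (β α : L2 n) (p : (Fin n → ℝ) × (Fin n → ℝ)) :
    ‖coeff lam β α ((reIm n).symm p)‖ = ‖oscIntegral lam (crossTerm β α p.2) p.1‖ := by
  rw [norm_eq_sqrt_re_inner (𝕜 := ℂ), inner_coeff_reIm_symm, ← norm_eq_sqrt_re_inner]

theorem inner_crossTerm (β α β' α' : L2 n) (ξ y : Fin n → ℝ) :
    ⟪crossTerm β α y ξ, crossTerm β' α' y ξ⟫ = ⟪β' ξ, β ξ⟫ * ⟪α (ξ + y), α' (ξ + y)⟫ := by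
  simp only [crossTerm, RCLike.inner_apply, map_mul, Complex.conj_conj]
  ring

theorem integrable_inner_crossTerm (β α β' α' : L2 n) :
    Integrable fun p : (Fin n → ℝ) × (Fin n → ℝ) =>
      ⟪crossTerm β α p.2 p.1, crossTerm β' α' p.2 p.1⟫ := by
  simp only [inner_crossTerm]
  exact (measurePreserving_prod_add volume volume).integrable_comp_of_integrable
    ((L2.integrable_inner β' β).mul_prod (L2.integrable_inner α α'))

theorem integral_inner_crossTerm (β α β' α' : L2 n) :
    ∫ p : (Fin n → ℝ) × (Fin n → ℝ),
      ⟪crossTerm β α p.2 p.1, crossTerm β' α' p.2 p.1⟫ = ⟪β', β⟫ * ⟪α, α'⟫ := by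
  simp only [inner_crossTerm]
  rw [L2.inner_def, L2.inner_def, ← integral_prod_mul]
  exact (measurePreserving_prod_add volume volume).integral_comp
    (MeasurableEquiv.shearAddRight (Fin n → ℝ)).measurableEmbedding
    fun p => ⟪β' p.1, β p.1⟫ * ⟪α p.2, α' p.2⟫

theorem integrable_norm_crossTerm_sq (β α : L2 n) :
    Integrable fun p : (Fin n → ℝ) × (Fin n → ℝ) => ‖crossTerm β α p.2 p.1‖ ^ 2 := by
  simpa only [norm_sq_eq_re_inner (𝕜 := ℂ)] using (integrable_inner_crossTerm β α β α).re

theorem integrable_crossTerm (β α : L2 n) (y : Fin n → ℝ) : Integrable (crossTerm β α y) :=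
  ((Lp.memLp α).comp_measurePreserving (measurePreserving_add_right volume y)).integrable_mul
    (Lp.memLp β).star

theorem ae_memLp_crossTerm (β α : L2 n) : ∀ᵐ y : Fin n → ℝ, MemLp (crossTerm β α y) 2 := by
  filter_upwards [(integrable_norm_crossTerm_sq β α).prod_left_ae] with y hy
  exact (memLp_two_iff_integrable_sq_norm (integrable_crossTerm β α y).1).2 hy

theorem memLp_coeff {lam : ℝ} (hlam : lam ≠ 0) (β α : L2 n) : MemLp (coeff lam β α) 2 := by
  refine (memLp_two_iff_integrable_sq_norm
    (continuous_coeff lam β α).aestronglyMeasurable).2 ?_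
  rw [← measurePreserving_reIm_symm.integrable_comp_emb (reIm n).symm.measurableEmbedding]
  have hmeas : Measurable fun p => ‖coeff lam β α ((reIm n).symm p)‖ ^ 2 :=
    ((continuous_coeff lam β α).measurable.comp (reIm n).symm.measurable).norm.pow_const 2
  refine (integrable_prod_iff' hmeas.aestronglyMeasurable).2 ⟨?_, ?_⟩
  · filter_upwards [ae_memLp_crossTerm β α] with y hy
    simp only [norm_coeff_reIm_symm]
    exact integrable_norm_oscIntegral_sq hlam (integrable_crossTerm β α y) hy
  · refine ((integrable_norm_crossTerm_sq β α).integral_prod_right.const_mul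
      (oscConst n lam)).congr ?_
    filter_upwards [ae_memLp_crossTerm β α] with y hy
    simp only [norm_pow, norm_norm, norm_coeff_reIm_symm]
    exact (integral_norm_oscIntegral_sq lam (integrable_crossTerm β α y) hy).symm

theorem integrable_inner_coeff {lam : ℝ} (hlam : lam ≠ 0) (β α β' α' : L2 n) :
    Integrable fun z => ⟪coeff lam β α z, coeff lam β' α' z⟫ :=
  (memLp_coeff hlam β' α').integrable_mul (memLp_coeff hlam β α).star

/-- **Moyal's identity**, i.e. the Schur orthogonality relations for `π_λ`. -/
theorem integral_inner_coeff {lam : ℝ} (hlam : lam ≠ 0) (β α β' α' : L2 n) :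
    ∫ z, ⟪coeff lam β α z, coeff lam β' α' z⟫ =
      oscConst n lam * (⟪β', β⟫ * ⟪α, α'⟫) := by
  let F (z : Fin n → ℂ) : ℂ := ⟪coeff lam β α z, coeff lam β' α' z⟫
  have hF : Integrable fun p => F ((reIm n).symm p) :=
    measurePreserving_reIm_symm.integrable_comp_of_integrable
      (integrable_inner_coeff hlam β α β' α')
  calc ∫ z, F z
      = ∫ p, F ((reIm n).symm p) := (measurePreserving_reIm_symm.integral_comp' F).symm
    _ = ∫ y, ∫ x, F ((reIm n).symm (x, y)) := integral_prod_symm _ hF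
    _ = ∫ y, oscConst n lam * ∫ ξ, ⟪crossTerm β α y ξ, crossTerm β' α' y ξ⟫ := by
        refine integral_congr_ae ?_
        filter_upwards [ae_memLp_crossTerm β α, ae_memLp_crossTerm β' α'] with y hy hy'
        simp only [F, inner_coeff_reIm_symm]
        exact integral_inner_oscIntegral lam (integrable_crossTerm β α y) hy
          (integrable_crossTerm β' α' y) hy'
    _ = oscConst n lam * (⟪β', β⟫ * ⟪α, α'⟫) := by
        rw [integral_const_mul, ← integral_inner_crossTerm]
        congr 1
        exact (integral_prod_symm _ (integrable_inner_crossTerm β α β' α')).symm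

end Moyal

section WeylUniqueness

theorem schrodingerRep_of (lam : ℝ) (z : Fin n → ℂ) (t : ℝ) (φ : L2 n) :
    schrodingerRep n lam (of z t) φ =
      Complex.exp ((lam * t : ℝ) * Complex.I) • schrodingerRep n lam (of z 0) φ := by
  refine Lp.ext ?_
  filter_upwards [coeFn_schrodingerIsometry lam (of z t) φ,
    coeFn_schrodingerIsometry lam (of z 0) φ, Lp.coeFn_smul
      (Complex.exp ((lam * t : ℝ) * Complex.I)) (schrodingerRep n lam (of z 0) φ)]
    with ξ hzt hz hsmul
  have ht : (of z t).t = t := rfl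
  have ht0 : (of z 0).t = 0 := rfl
  rw [hsmul, Pi.smul_apply, schrodingerRep_apply, schrodingerRep_apply, hzt, hz, schrodingerFun,
    schrodingerFun, mul_comm Complex.I, ht, ht0, mul_zero, Complex.ofReal_zero, mul_zero,
    Complex.exp_zero, one_mul, mul_assoc]
  rfl

/-- The symplectic form `Im (z · w̄)` on `ℂⁿ`, through which translations and `π_λ` interact. -/
def symp (z w : Fin n → ℂ) : ℝ := (∑ j, z j * starRingEnd ℂ (w j)).im

theorem symp_swap (z w : Fin n → ℂ) : symp w z = -symp z w := by
  rw [symp, symp, ← Complex.conj_im, map_sum]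
  simp only [map_mul, Complex.conj_conj, mul_comm]

theorem schrodingerRep_of_of (lam : ℝ) (z w : Fin n → ℂ) (φ : L2 n) :
    schrodingerRep n lam (of z 0) (schrodingerRep n lam (of w 0) φ) =
      Complex.exp ((lam * (1 / 2 * symp z w) : ℝ) * Complex.I) •
        schrodingerRep n lam (of (z + w) 0) φ := by
  have hmul : of z 0 * of w 0 = of (z + w) (1 / 2 * symp z w) := by
    refine HeisenbergGroup.ext rfl ?_
    change 0 + 0 + 1 / 2 * symp z w = 1 / 2 * symp z w
    rw [add_zero, zero_add]
  rw [← schrodingerRep_of, ← hmul, map_mul]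
  rfl

theorem coeff_schrodingerRep (lam : ℝ) (β α : L2 n) (z w : Fin n → ℂ) :
    coeff lam (schrodingerRep n lam (of w 0) β) (schrodingerRep n lam (of w 0) α) z =
      Complex.exp ((lam * symp z w : ℝ) * Complex.I) * coeff lam β α z := by
  have hcomm : schrodingerRep n lam (of z 0) (schrodingerRep n lam (of w 0) α) =
      Complex.exp ((lam * symp z w : ℝ) * Complex.I) •
        schrodingerRep n lam (of w 0) (schrodingerRep n lam (of z 0) α) := by
    rw [schrodingerRep_of_of, schrodingerRep_of_of, smul_smul, ← Complex.exp_add, symp_swap z w,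
      add_comm w z]
    congr 2
    push_cast
    ring
  rw [coeff, hcomm, inner_smul_right, LinearIsometryEquiv.inner_map_map, coeff]

theorem exists_symp_eq {lam : ℝ} (hlam : lam ≠ 0) (L : StrongDual ℝ (Fin n → ℂ)) :
    ∃ w : Fin n → ℂ, ∀ z, lam * symp z w = L z := by
  refine ⟨fun j => ⟨L (Pi.single j Complex.I) / lam, -(L (Pi.single j 1) / lam)⟩, fun z => ?_⟩
  have hsingle (j : Fin n) : (Pi.single j (z j) : Fin n → ℂ) =
      (z j).re • (Pi.single j 1 : Fin n → ℂ) + (z j).im • (Pi.single j Complex.I : Fin n → ℂ) := by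
    rw [← Pi.single_smul, ← Pi.single_smul, ← Pi.single_add]
    congr 1
    apply Complex.ext <;> simp
  have hL : L z = ∑ j, L (Pi.single j (z j)) := by
    rw [← map_sum, Finset.univ_sum_single]
  rw [hL, symp, Complex.im_sum, Finset.mul_sum]
  refine Finset.sum_congr rfl fun j _ => ?_
  rw [hsingle, map_add, map_smul, map_smul, Complex.mul_im, Complex.conj_re, Complex.conj_im,
    smul_eq_mul, smul_eq_mul]
  field_simp

theorem nontrivial_L2 (n : ℕ) : Nontrivial (L2 n) := by
  refine nontrivial_of_ne (indicatorConstLp 2 (measurableSet_ball (x := (0 : Fin n → ℝ)) (ε := 1))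
    measure_ball_lt_top.ne 1) 0 (norm_ne_zero_iff.1 ?_)
  rw [norm_indicatorConstLp (by norm_num) (by norm_num), norm_one, one_mul]
  have hball : 0 < volume.real (Metric.ball (0 : Fin n → ℝ) 1) :=
    ENNReal.toReal_pos (Metric.measure_ball_pos volume _ one_pos).ne' measure_ball_lt_top.ne
  exact (Real.rpow_pos_of_pos hball _).ne'

theorem exists_coeff_ne_zero (lam : ℝ) (z : Fin n → ℂ) : ∃ β α : L2 n, coeff lam β α z ≠ 0 := by
  have := nontrivial_L2 n
  obtain ⟨α, hα⟩ := exists_ne (0 : L2 n)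
  refine ⟨schrodingerRep n lam (of z 0) α, α, inner_self_ne_zero.2 ?_⟩
  rwa [Ne, LinearIsometryEquiv.map_eq_zero_iff]

theorem ae_eq_zero_of_integral_mul_coeff {lam : ℝ} (hlam : lam ≠ 0) {G : (Fin n → ℂ) → ℂ}
    (hG : ∀ β α : L2 n, Integrable fun z => G z * coeff lam β α z)
    (h : ∀ β α : L2 n, ∫ z, G z * coeff lam β α z = 0) : G =ᵐ[volume] 0 := by
  -- Replacing `(β, α)` by `(π_λ(w, 0) β, π_λ(w, 0) α)` multiplies the coefficient by a character.
  have hmul_eq_zero (β α : L2 n) : (fun z => G z * coeff lam β α z) =ᵐ[volume] 0 := by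
    refine ae_eq_zero_of_integral_cexp_smul (hG β α) fun L => ?_
    obtain ⟨w, hw⟩ := exists_symp_eq hlam L
    rw [← h (schrodingerRep n lam (of w 0) β) (schrodingerRep n lam (of w 0) α)]
    refine integral_congr_ae (Eventually.of_forall fun z => ?_)
    simp only [coeff_schrodingerRep, hw, smul_eq_mul, mul_left_comm]
  refine measure_null_of_locally_null _ fun z₀ _ => ?_
  obtain ⟨β, α, hz₀⟩ := exists_coeff_ne_zero lam z₀
  refine ⟨{z | coeff lam β α z ≠ 0} ∩ {z | G z = 0}ᶜ, ?_, ?_⟩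
  · exact inter_mem (mem_nhdsWithin_of_mem_nhds
      ((continuous_coeff lam β α).continuousAt.eventually_ne hz₀)) self_mem_nhdsWithin
  · exact measure_mono_null (fun z hz hGz => mul_ne_zero hz.2 hz.1 hGz) (hmul_eq_zero β α)

end WeylUniqueness

section OrbitFrame

variable {m : ℕ}

/-- The orbit map `z ↦ (π_λ(z, 0)⁻¹ e_i)_i`. Its inner products with the vectors `(a_i)_i` are the
sums of matrix coefficients `∑ i, ⟪e_i, π_λ(z, 0) a_i⟫`. -/
def orbit (lam : ℝ) (e : Fin m → L2 n) (z : Fin n → ℂ) : PiLp 2 fun _ : Fin m => L2 n :=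
  WithLp.toLp 2 fun i => (schrodingerRep n lam (of z 0)).symm (e i)

theorem inner_orbit (lam : ℝ) (e : Fin m → L2 n) (a : PiLp 2 fun _ : Fin m => L2 n)
    (z : Fin n → ℂ) : ⟪orbit lam e z, a⟫ = ∑ i, coeff lam (e i) (a i) z := by
  rw [PiLp.inner_apply]
  refine Finset.sum_congr rfl fun i _ => ?_
  rw [coeff, ← LinearIsometryEquiv.inner_map_map (schrodingerRep n lam (of z 0)) (orbit lam e z i),
    orbit, LinearIsometryEquiv.apply_symm_apply]

theorem norm_orbit_sq (lam : ℝ) {e : Fin m → L2 n} (he : Orthonormal ℂ e) (z : Fin n → ℂ) :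
    ‖orbit lam e z‖ ^ 2 = m := by
  simp [PiLp.norm_sq_eq_of_L2, orbit, he.1]

theorem continuous_inner_orbit (lam : ℝ) (e : Fin m → L2 n) (a : PiLp 2 fun _ : Fin m => L2 n) :
    Continuous fun z => ⟪orbit lam e z, a⟫ := by
  simp only [inner_orbit]
  exact continuous_finsetSum _ fun i _ => continuous_coeff lam _ _

theorem memLp_inner_orbit {lam : ℝ} (hlam : lam ≠ 0) (e : Fin m → L2 n)
    (a : PiLp 2 fun _ : Fin m => L2 n) : MemLp (fun z => ⟪orbit lam e z, a⟫) 2 := by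
  simp only [inner_orbit]
  exact memLp_finsetSum _ fun i _ => memLp_coeff hlam _ _

theorem integrable_inner_orbit_mul_coeff {lam : ℝ} (hlam : lam ≠ 0) (e : Fin m → L2 n)
    (a : PiLp 2 fun _ : Fin m => L2 n) (β α : L2 n) :
    Integrable fun z => ⟪a, orbit lam e z⟫ * coeff lam β α z := by
  simp only [← inner_conj_symm a]
  exact (memLp_inner_orbit hlam e a).star.integrable_mul (memLp_coeff hlam β α)

theorem integral_inner_orbit_mul_coeff {lam : ℝ} (hlam : lam ≠ 0) (e : Fin m → L2 n)
    (a : PiLp 2 fun _ : Fin m => L2 n) (β α : L2 n) :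
    ∫ z, ⟪a, orbit lam e z⟫ * coeff lam β α z =
      oscConst n lam * ∑ i, ⟪β, e i⟫ * ⟪a i, α⟫ := by
  have hsum (z : Fin n → ℂ) : ⟪a, orbit lam e z⟫ * coeff lam β α z =
      ∑ i, ⟪coeff lam (e i) (a i) z, coeff lam β α z⟫ := by
    rw [← inner_conj_symm, inner_orbit, ← sum_inner, RCLike.inner_apply, mul_comm]
  simp only [hsum]
  rw [integral_finsetSum _ fun i _ => integrable_inner_coeff hlam _ _ _ _, Finset.mul_sum]
  exact Finset.sum_congr rfl fun i _ => integral_inner_coeff hlam _ _ _ _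

theorem integral_norm_inner_orbit_sq {lam : ℝ} (hlam : lam ≠ 0) {e : Fin m → L2 n}
    (he : Orthonormal ℂ e) (a : PiLp 2 fun _ : Fin m => L2 n) :
    ∫ z, ‖⟪orbit lam e z, a⟫‖ ^ 2 = oscConst n lam * ‖a‖ ^ 2 := by
  have hsum (z : Fin n → ℂ) : ((‖⟪orbit lam e z, a⟫‖ ^ 2 : ℝ) : ℂ) =
      ∑ j, ⟪a, orbit lam e z⟫ * coeff lam (e j) (a j) z := by
    rw [← Finset.mul_sum, ← inner_orbit, ← inner_conj_symm a, Complex.conj_mul', Complex.ofReal_pow]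
  have hdiag (j : Fin m) : ∑ i, ⟪e j, e i⟫ * ⟪a i, a j⟫ = ⟪a j, a j⟫ := by
    simp only [orthonormal_iff_ite.1 he, ite_mul, one_mul, zero_mul, Finset.sum_ite_eq,
      Finset.mem_univ, if_true]
  apply Complex.ofReal_injective
  rw [← integral_complex_ofReal]
  simp only [hsum]
  rw [integral_finsetSum _ fun j _ => integrable_inner_orbit_mul_coeff hlam e a _ _]
  simp only [integral_inner_orbit_mul_coeff hlam, hdiag]
  rw [← Finset.mul_sum, ← PiLp.inner_apply, inner_self_eq_norm_sq_to_K, Complex.ofReal_mul,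
    Complex.ofReal_pow]
  rfl

theorem isTightFrame_orbit {lam : ℝ} (hlam : lam ≠ 0) {e : Fin m → L2 n}
    (he : Orthonormal ℂ e) : IsTightFrame ℂ volume (oscConst n lam) (orbit lam e) :=
  ⟨memLp_inner_orbit hlam e, integral_norm_inner_orbit_sq hlam he⟩

theorem exists_inner_orbit_eq_zero_iff (lam : ℝ) (e : Fin m → L2 n) (w : Fin n → ℂ)
    (a : PiLp 2 fun _ : Fin m => L2 n) :
    ∃ b, ∀ z, ⟪orbit lam e z, b⟫ = 0 ↔ ⟪orbit lam e (z + w), a⟫ = 0 := by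
  refine ⟨WithLp.toLp 2 fun i => schrodingerRep n lam (of w 0) (a i), fun z => ?_⟩
  simp only [inner_orbit, coeff, schrodingerRep_of_of, inner_smul_right, ← Finset.mul_sum,
    mul_eq_zero, Complex.exp_ne_zero, false_or]

theorem eq_zero_of_measure_inner_orbit_ne_top (hn : 1 ≤ n) {lam : ℝ} (hlam : lam ≠ 0)
    {e : Fin m → L2 n} (he : Orthonormal ℂ e) {a : PiLp 2 fun _ : Fin m => L2 n}
    (hfin : volume {z | ⟪orbit lam e z, a⟫ ≠ 0} ≠ ∞) : a = 0 := by
  have : Nonempty (Fin n) := ⟨⟨0, hn⟩⟩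
  have : NoncompactSpace (Fin n → ℂ) := NormedSpace.noncompactSpace ℝ _
  exact (isTightFrame_orbit hlam he).eq_zero_of_measure_ne_top
    (fun z => (norm_orbit_sq lam he z).le) (oscConst_pos n hlam)
    (exists_inner_orbit_eq_zero_iff lam e)
    ((continuous_inner_orbit lam e a).isOpen_preimage _ isOpen_ne).measurableSet hfin

end OrbitFrame

section WeylTransform

theorem integrable_mul_coeff {g : (Fin n → ℂ) → ℂ} (hg : Integrable g) (lam : ℝ) (β α : L2 n) :
    Integrable fun z => g z * coeff lam β α z :=
  hg.mul_bdd (c := ‖β‖ * ‖α‖) (continuous_coeff lam β α).aestronglyMeasurable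
    (Eventually.of_forall (norm_coeff_le lam β α))

theorem ae_eq_inner_orbit {m : ℕ} {lam : ℝ} (hlam : lam ≠ 0) {g : (Fin n → ℂ) → ℂ}
    (hg : Integrable g) {T : L2 n → L2 n} (hT : ∀ β α, ∫ z, g z * coeff lam β α z = ⟪β, T α⟫)
    {e : Fin m → L2 n} {a : PiLp 2 fun _ : Fin m => L2 n}
    (hTea : ∀ α, T α = ∑ i, ⟪a i, α⟫ • e i) :
    ∀ᵐ z, oscConst n lam * g z = ⟪a, orbit lam e z⟫ := by
  have hgi (β α : L2 n) : Integrable fun z => oscConst n lam * (g z * coeff lam β α z) :=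
    (integrable_mul_coeff hg lam β α).const_mul _
  have hoi := integrable_inner_orbit_mul_coeff hlam e a
  have hdiff : (fun z => oscConst n lam * g z - ⟪a, orbit lam e z⟫) =ᵐ[volume] 0 := by
    refine ae_eq_zero_of_integral_mul_coeff hlam (fun β α => ?_) fun β α => ?_ <;>
      simp only [sub_mul, mul_assoc]
    · exact (hgi β α).sub (hoi β α)
    · rw [integral_sub (hgi β α) (hoi β α), integral_const_mul, hT, hTea, inner_sum,
        integral_inner_orbit_mul_coeff hlam]
      simp only [inner_smul_right, mul_comm, sub_self]
  filter_upwards [hdiff] with z hz using sub_eq_zero.1 hz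

/-- **Benedicks' theorem** for the Weyl transform. -/
theorem ae_eq_zero_of_finiteDimensional_range (hn : 1 ≤ n) {lam : ℝ} (hlam : lam ≠ 0)
    {g : (Fin n → ℂ) → ℂ} (hg : Integrable g) (hfin : volume {z | g z ≠ 0} ≠ ∞)
    {T : L2 n →L[ℂ] L2 n} (hrank : FiniteDimensional ℂ (LinearMap.range T.toLinearMap))
    (hT : ∀ β α : L2 n, ∫ z, g z * coeff lam β α z = ⟪β, T α⟫) : g =ᵐ[volume] 0 := by
  obtain ⟨m, e, a, he, hTea⟩ := exists_orthonormal_eq_sum_inner_smul T hrank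
  have hc : (oscConst n lam : ℂ) ≠ 0 := Complex.ofReal_ne_zero.2 (oscConst_pos n hlam).ne'
  have hinv := ae_eq_inner_orbit hlam hg hT (a := WithLp.toLp 2 a) hTea
  have ha := eq_zero_of_measure_inner_orbit_ne_top hn hlam he (a := WithLp.toLp 2 a) <| by
    refine ne_top_of_le_ne_top hfin (measure_mono_ae ?_)
    filter_upwards [hinv] with z hz ho hgz
    rw [hgz, mul_zero] at hz
    exact ho (inner_eq_zero_symm.1 hz.symm)
  filter_upwards [hinv] with z hz
  rw [ha, inner_zero_left] at hz
  exact (mul_eq_zero.1 hz).resolve_left hc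

end WeylTransform

section CentralFourier

/-- The partial Fourier transform `f^λ(z) = ∫ f(z, t) e^{iλt} dt` in the central variable. -/
def centralFourier (f : Lp ℂ 1 (volume : Measure (HeisenbergGroup n))) (lam : ℝ)
    (z : Fin n → ℂ) : ℂ := ∫ t, Complex.exp ((lam * t : ℝ) * Complex.I) • f (of z t)

variable {f : Lp ℂ 1 (volume : Measure (HeisenbergGroup n))} {A : Set (Fin n → ℂ)}

theorem integrable_comp_of (f : Lp ℂ 1 (volume : Measure (HeisenbergGroup n))) :
    Integrable (fun p : (Fin n → ℂ) × ℝ => f (of p.1 p.2)) :=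
  L1.integrable_coeFn f

theorem integrable_cexp_smul_comp_of (f : Lp ℂ 1 (volume : Measure (HeisenbergGroup n)))
    (lam : ℝ) : Integrable fun p : (Fin n → ℂ) × ℝ =>
      Complex.exp ((lam * p.2 : ℝ) * Complex.I) • f (of p.1 p.2) :=
  integrable_cexp_smul (integrable_comp_of f) (θ := fun p => lam * p.2) (by fun_prop)

theorem integrable_centralFourier (f : Lp ℂ 1 (volume : Measure (HeisenbergGroup n)))
    (lam : ℝ) : Integrable (centralFourier f lam) :=
  (integrable_cexp_smul_comp_of f lam).integral_prod_left

theorem integral_centralFourier_mul_coeff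
    (f : Lp ℂ 1 (volume : Measure (HeisenbergGroup n))) (lam : ℝ) (β α : L2 n) :
    ∫ z, centralFourier f lam z * coeff lam β α z = ⟪β, fourierTransform f lam α⟫ := by
  let F (p : (Fin n → ℂ) × ℝ) : ℂ :=
    Complex.exp ((lam * p.2 : ℝ) * Complex.I) • f (of p.1 p.2) * coeff lam β α p.1
  have hF : Integrable F := (integrable_cexp_smul_comp_of f lam).mul_bdd (c := ‖β‖ * ‖α‖)
    ((continuous_coeff lam β α).comp continuous_fst).aestronglyMeasurable
    (Eventually.of_forall fun p => norm_coeff_le lam β α p.1)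
  have hpoint (p : (Fin n → ℂ) × ℝ) :
      F p = ⟪β, f (of p.1 p.2) • schrodingerRep n lam (of p.1 p.2) α⟫ := by
    rw [schrodingerRep_of, smul_smul, inner_smul_right, mul_comm (f _)]
    rfl
  calc ∫ z, centralFourier f lam z * coeff lam β α z
      = ∫ z, ∫ t, F (z, t) := by simp only [F, integral_mul_const, centralFourier]
    _ = ∫ p, F p := (integral_prod F hF).symm
    _ = ∫ g : HeisenbergGroup n, ⟪β, f g • schrodingerRep n lam g α⟫ :=
        integral_congr_ae (Eventually.of_forall hpoint)
    _ = ⟪β, fourierTransform f lam α⟫ := by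
        rw [fourierTransform_apply, ← integral_inner (integrable_schrodingerRep lam f α)]

theorem ae_mem_of_centralFourier_ne_zero
    (hfA : ∀ᵐ g : HeisenbergGroup n, f g ≠ 0 → g.z ∈ A) (lam : ℝ) :
    ∀ᵐ z, centralFourier f lam z ≠ 0 → z ∈ A := by
  have hprod : ∀ᵐ p : (Fin n → ℂ) × ℝ, f (of p.1 p.2) ≠ 0 → p.1 ∈ A := hfA
  filter_upwards [Measure.ae_ae_of_ae_prod hprod] with z hz hne
  by_contra hzA
  refine hne (integral_eq_zero_of_ae ?_)
  filter_upwards [hz] with t ht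
  rw [not_not.1 fun h => hzA (ht h), smul_zero, Pi.zero_apply]

theorem eq_zero_of_centralFourier_ae_eq_zero {D : Set ℝ} (hD : Dense D)
    (h : ∀ lam ∈ D, centralFourier f lam =ᵐ[volume] 0) : f = 0 := by
  obtain ⟨C, hCD, hCcount, hC⟩ := hD.exists_countable_dense_subset
  have hzero : ∀ᵐ z, ∀ lam ∈ C, centralFourier f lam z = 0 :=
    (ae_ball_iff hCcount).2 fun lam hlam => h lam (hCD hlam)
  have hfiber : ∀ᵐ z, ∀ᵐ t, f (of z t) = 0 := by
    filter_upwards [hzero, (integrable_comp_of f).prod_right_ae] with z hz hint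
    exact ae_eq_zero_of_integral_cexp_smul_of_dense hint hC hz
  have hmeas : MeasurableSet {p : (Fin n → ℂ) × ℝ | f (of p.1 p.2) = 0} :=
    (Lp.stronglyMeasurable f).measurable (measurableSet_singleton 0)
  exact Lp.eq_zero_iff_ae_eq_zero.2 ((Measure.ae_prod_iff_ae_ae hmeas).2 hfiber)

end CentralFourier

end HeisenbergGroup

theorem theorem6p6_general {n : ℕ} (hn : 1 ≤ n) {A : Set (Fin n → ℂ)} (hA : volume A < ∞)
    {f : Lp ℂ 1 (volume : Measure (HeisenbergGroup n))}
    (hfA : ∀ᵐ g : HeisenbergGroup n, f g ≠ 0 → g.z ∈ A) {D : Set ℝ} (hD : Dense D)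
    (hrank : ∀ lam ∈ D, lam ≠ 0 → FiniteDimensional ℂ
      (LinearMap.range (HeisenbergGroup.fourierTransform f lam).toLinearMap)) : f = 0 := by
  refine HeisenbergGroup.eq_zero_of_centralFourier_ae_eq_zero (hD.sdiff_singleton 0)
    fun lam ⟨hlamD, hlam⟩ => ?_
  have hsupp : volume {z | HeisenbergGroup.centralFourier f lam z ≠ 0} ≤ volume A :=
    measure_mono_ae (HeisenbergGroup.ae_mem_of_centralFourier_ne_zero hfA lam)
  exact HeisenbergGroup.ae_eq_zero_of_finiteDimensional_range hn hlam
    (HeisenbergGroup.integrable_centralFourier f lam) (hsupp.trans_lt hA).ne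
    (hrank lam hlamD hlam) (HeisenbergGroup.integral_centralFourier_mul_coeff f lam)

end

theorem theorem6p6 (n : ℕ) (hn : 1 ≤ n) (A : Set (Fin n → ℂ)) (hA : volume A < ∞)
    (f : Lp ℂ 1 (volume : Measure (HeisenbergGroup n)))
    (hfA : ∀ᵐ g : HeisenbergGroup n, f g ≠ 0 → g.z ∈ A)
    (hrank : ∀ lam : ℝ, lam ≠ 0 →
      FiniteDimensional ℂ
        (LinearMap.range (HeisenbergGroup.fourierTransform f lam).toLinearMap)) :
    f = 0 :=
  theorem6p6_general hn hA hfA dense_univ fun lam _ => hrank lam
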